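/- A finite simple graph $G$ is \emph{representable} in $\mathbb{R}^m$ if there are an injective map $f : V(G) \to \mathbb{R}^m$ and distinct positive real constants $\alpha, \beta$ such that for all distinct vertices $u, v$ the Euclidean distance $\|f(u)-f(v)\|$ equals $\alpha$ if $u$ and $v$ are adjacent, and equals $\beta$ otherwise. The graph $G$ is \emph{vertex-transitive} if its automorphism group acts transitively on its vertices. \textbf{Corollary.} Let $G$ be a vertex-transitive simple graph on $n$ vertices, where $n$ is odd, and suppose that $G$ is neither the complete graph nor the empty (edgeless) graph. Then $n \ge 3$, and $G$ is representable in $\mathbb{R}^{n-3}$. -/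

import Mathlib

namespace SimpleGraph

/-- `G` is representable in `ℝ^m`: there are an embedding `f` of the vertex set in Euclidean
`m`-space and distinct positive constants `α`, `β` such that distinct vertices are mapped to points
at distance `α` if they are adjacent, and at distance `β` otherwise. -/
def IsRepresentable {V : Type*} (G : SimpleGraph V) (m : ℕ) : Prop :=
  ∃ (f : V ↪ EuclideanSpace ℝ (Fin m)) (α β : ℝ), 0 < α ∧ 0 < β ∧ α ≠ β ∧
    ∀ u v : V, u ≠ v → (G.Adj u v → ‖f u - f v‖ = α) ∧ (¬ G.Adj u v → ‖f u - f v‖ = β)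

/-- `G` is vertex-transitive: its automorphism group acts transitively on the vertices. -/
def IsVertexTransitive {V : Type*} (G : SimpleGraph V) : Prop :=
  ∀ u v : V, ∃ φ : G ≃g G, φ u = v

end SimpleGraph

open Matrix Module

/-! For `s = ±1` and adjacency matrix `A`, let `l` be the least eigenvalue of `s • A` on the
sum-zero hyperplane. For suitable `c`, `s • A - l • 1` plus the constant matrix `c` is positive
semidefinite and kills `1` and an eigenvector `x`. Odd order and transitivity give a third
independent kernel vector, a translate of `x`, so this is a Gram matrix in dimension `n - 3`. Its
squared distances are `-2l - 2s` on edges and `-2l` on non-edges; the signs `s = 1` and `s = -1`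
cannot both make one of them vanish. -/

theorem exists_linearIsometry_of_finrank_le {W : Type*} [NormedAddCommGroup W]
    [InnerProductSpace ℝ W] [FiniteDimensional ℝ W] {d : ℕ} (h : finrank ℝ W ≤ d) :
    Nonempty (W →ₗᵢ[ℝ] EuclideanSpace ℝ (Fin d)) := by
  let b := stdOrthonormalBasis ℝ W
  let e := EuclideanSpace.basisFun (Fin d) ℝ
  let L : W →ₗ[ℝ] EuclideanSpace ℝ (Fin d) :=
    b.toBasis.constr ℝ fun i => e (Fin.castLE h i)
  have hL : L ∘ b.toBasis = e ∘ Fin.castLE h := by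
    funext i
    simp only [Function.comp_apply, L, Basis.constr_basis]
  refine ⟨L.isometryOfOrthonormal (v := b.toBasis) ?_ ?_⟩
  · simp
  · rw [hL]
    exact e.orthonormal.comp _ (Fin.castLE_injective h)

open scoped MatrixOrder in
/-- A positive semidefinite matrix of rank at most `d` is the Gram matrix of vectors in `ℝ^d`;
in particular it determines their mutual distances. -/
theorem Matrix.PosSemidef.exists_norm_sub_sq {n : Type*} [Fintype n] {M : Matrix n n ℝ}
    (hM : M.PosSemidef) {d : ℕ} (hd : M.rank ≤ d) :
    ∃ f : n → EuclideanSpace ℝ (Fin d),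
      ∀ u v, ‖f u - f v‖ ^ 2 = M u u + M v v - 2 * M u v := by
  classical
  obtain ⟨B, rfl⟩ := CStarAlgebra.nonneg_iff_eq_star_mul_self.mp hM.nonneg
  rw [star_eq_conjTranspose, rank_conjTranspose_mul_self] at hd
  let e := (WithLp.linearEquiv 2 ℝ (n → ℝ)).symm
  let W := (LinearMap.range B.mulVecLin).map e.toLinearMap
  have hW : finrank ℝ W ≤ d := by
    rw [LinearEquiv.finrank_map_eq]
    exact hd
  obtain ⟨L⟩ := exists_linearIsometry_of_finrank_le hW
  let g : n → W := fun u =>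
    ⟨e (B *ᵥ Pi.single u 1), Submodule.mem_map_of_mem ⟨Pi.single u 1, rfl⟩⟩
  refine ⟨fun u => L (g u), fun u v => ?_⟩
  rw [← map_sub, L.norm_map, Submodule.coe_norm, EuclideanSpace.norm_sq_eq]
  have hg : ∀ u v i, (((g u - g v : W) : EuclideanSpace ℝ n)) i = B i u - B i v := by
    intro u v i
    simp [g, e]
  simp only [hg, mul_apply, star_apply, star_trivial, Real.norm_eq_abs, sq_abs, Finset.mul_sum,
    ← Finset.sum_add_distrib, ← Finset.sum_sub_distrib]
  exact Finset.sum_congr rfl fun i _ => by ring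

/-- The Rayleigh quotient attains its minimum by compactness of the unit sphere in the hyperplane.
-/
theorem exists_isMinOn_sum_zero_sphere {n : Type*} [Fintype n] [Nontrivial n]
    (A : Matrix n n ℝ) :
    ∃ x : n → ℝ, x ⬝ᵥ 1 = 0 ∧ x ⬝ᵥ x = 1 ∧
      ∀ y : n → ℝ, y ⬝ᵥ 1 = 0 → (x ⬝ᵥ A *ᵥ x) * (y ⬝ᵥ y) ≤ y ⬝ᵥ A *ᵥ y := by
  classical
  let S : Set (n → ℝ) := {x | x ⬝ᵥ 1 = 0 ∧ x ⬝ᵥ x = 1}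
  have hclosed : IsClosed S :=
    (isClosed_eq (by fun_prop) continuous_const).inter
      (isClosed_eq (by fun_prop) continuous_const)
  have hcompact : IsCompact S := by
    refine (isCompact_univ_pi fun _ : n => isCompact_Icc (a := (-1 : ℝ)) (b := 1)).of_isClosed_subset
      hclosed fun x hx i _ => ?_
    have h1 : x i * x i ≤ x ⬝ᵥ x :=
      Finset.single_le_sum (f := fun j => x j * x j) (fun j _ => mul_self_nonneg _)
        (Finset.mem_univ i)
    rw [hx.2] at h1
    exact ⟨by nlinarith, by nlinarith⟩
  have hscale : ∀ y : n → ℝ, y ⬝ᵥ 1 = 0 → y ≠ 0 →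
      (Real.sqrt (y ⬝ᵥ y))⁻¹ • y ∈ S := by
    intro y hy hy0
    have hpos : 0 < y ⬝ᵥ y := by simpa using dotProduct_star_self_pos_iff.mpr hy0
    refine ⟨by simp [hy], ?_⟩
    rw [smul_dotProduct, dotProduct_smul, smul_eq_mul, smul_eq_mul, ← mul_assoc, ← mul_inv,
      Real.mul_self_sqrt hpos.le, inv_mul_cancel₀ hpos.ne']
  obtain ⟨u, v, huv⟩ := exists_pair_ne n
  have hne : S.Nonempty := by
    refine ⟨_, hscale (Pi.single u 1 - Pi.single v 1) (by simp [sub_dotProduct]) fun h => ?_⟩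
    simpa [huv] using congrFun h u
  obtain ⟨x, hxS, hx⟩ := hcompact.exists_isMinOn hne
    (f := fun x => x ⬝ᵥ A *ᵥ x) (by fun_prop)
  refine ⟨x, hxS.1, hxS.2, fun y hy => ?_⟩
  rcases eq_or_ne y 0 with rfl | hy0
  · simp
  have hpos : 0 < y ⬝ᵥ y := by simpa using dotProduct_star_self_pos_iff.mpr hy0
  have h := hx (hscale y hy hy0)
  simp only [Set.mem_ofPred_eq, mulVec_smul, smul_dotProduct, dotProduct_smul, smul_eq_mul] at h
  rw [← mul_assoc, ← mul_inv, Real.mul_self_sqrt hpos.le, inv_mul_eq_div, le_div_iff₀ hpos] at h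
  exact h

/-- Subtracting the least eigenvalue on the hyperplane of vectors with zero sum, and adding a
constant matrix, makes a symmetric matrix with constant row sums positive semidefinite. -/
theorem Matrix.IsSymm.exists_posSemidef_sub_smul_one_add_const {n : Type*} [Fintype n]
    [DecidableEq n] [Nontrivial n] {A : Matrix n n ℝ} (hA : A.IsSymm) {k : ℝ}
    (hk : A *ᵥ 1 = k • 1) :
    ∃ (l c : ℝ) (x : n → ℝ), x ≠ 0 ∧ x ⬝ᵥ 1 = 0 ∧
      (A - l • 1 + of fun _ _ => c).PosSemidef ∧
      (A - l • 1 + of fun _ _ => c) *ᵥ 1 = 0 ∧ (A - l • 1 + of fun _ _ => c) *ᵥ x = 0 := by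
  obtain ⟨x, hx1, hxx, hx⟩ := exists_isMinOn_sum_zero_sphere A
  set l := x ⬝ᵥ A *ᵥ x with hl
  have hn : (Fintype.card n : ℝ) ≠ 0 := by
    exact_mod_cast Fintype.card_ne_zero
  -- This is the row sum of the shifted matrix, so `c` puts `1` in its kernel.
  obtain ⟨c, hc⟩ : ∃ c : ℝ, k - l + Fintype.card n * c = 0 :=
    ⟨(l - k) / Fintype.card n, by field_simp; ring⟩
  set M := A - l • 1 + of fun _ _ => c with hM
  have hMsymm : M.IsSymm := by
    ext i j
    simp [hM, hA.apply i j, one_apply, eq_comm]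
  have hM1 : M *ᵥ 1 = 0 := by
    rw [hM, add_mulVec, sub_mulVec, hk, smul_mulVec, one_mulVec]
    ext i
    simpa [mulVec, dotProduct] using hc
  have hform : ∀ y : n → ℝ, y ⬝ᵥ 1 = 0 → y ⬝ᵥ M *ᵥ y = y ⬝ᵥ A *ᵥ y - l * (y ⬝ᵥ y) := by
    intro y hy
    have hJ : (of fun _ _ : n => c) *ᵥ y = 0 := by
      ext i
      have : ∑ j, y j = 0 := by simpa [dotProduct] using hy
      simp [mulVec, dotProduct, ← Finset.mul_sum, this]
    rw [hM, add_mulVec, hJ, add_zero, sub_mulVec, smul_mulVec, one_mulVec, dotProduct_sub,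
      dotProduct_smul, smul_eq_mul]
  have hpsd : M.PosSemidef := by
    refine posSemidef_iff_dotProduct_mulVec.mpr ⟨by simpa [IsHermitian] using hMsymm.eq, fun y => ?_⟩
    -- Subtracting the mean leaves the quadratic form unchanged, since `M` kills `1`.
    obtain ⟨a, ha⟩ : ∃ a : ℝ, (y - a • 1) ⬝ᵥ 1 = 0 := by
      refine ⟨(y ⬝ᵥ 1) / Fintype.card n, ?_⟩
      rw [sub_dotProduct, smul_dotProduct, smul_eq_mul]
      simp [hn]
    have h1 : (1 : n → ℝ) ⬝ᵥ M *ᵥ y = 0 := by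
      rw [dotProduct_mulVec, ← mulVec_transpose, hMsymm.eq, hM1, zero_dotProduct]
    have h2 : (y - a • 1) ⬝ᵥ M *ᵥ (y - a • 1) = y ⬝ᵥ M *ᵥ y := by
      rw [mulVec_sub, mulVec_smul, hM1, smul_zero, sub_zero, sub_dotProduct, smul_dotProduct, h1,
        smul_zero, sub_zero]
    rw [star_trivial, ← h2, hform _ ha, sub_nonneg]
    exact hx _ ha
  refine ⟨l, c, x, ?_, hx1, hpsd, hM1, ?_⟩
  · rintro rfl
    simp at hxx
  · rw [← hpsd.dotProduct_mulVec_zero_iff, star_trivial, hform x hx1, hxx, mul_one, ← hl, sub_self]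

/-- Parity: an odd number of signs `±1` cannot sum to zero. -/
theorem eq_zero_of_sum_eq_zero_of_sq_eq {n : Type*} [Fintype n] (hn : Odd (Fintype.card n))
    {x : n → ℝ} (hsum : ∑ i, x i = 0) (hx : ∀ i j, x i ^ 2 = x j ^ 2) : x = 0 := by
  by_contra hx0
  obtain ⟨i, hi⟩ := Function.ne_iff.mp hx0
  have hε : ∀ j, ∃ ε : ℤ, Odd ε ∧ x j = ε * x i := by
    intro j
    rcases sq_eq_sq_iff_eq_or_eq_neg.mp (hx j i) with h | h
    · exact ⟨1, odd_one, by simp [h]⟩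
    · exact ⟨-1, by decide, by simp [h]⟩
  choose ε hodd hxε using hε
  have h0 : ∑ j, ε j = 0 := by
    rw [Finset.sum_congr rfl fun j _ => hxε j, ← Finset.sum_mul] at hsum
    exact_mod_cast (mul_eq_zero.mp hsum).resolve_right hi
  have h2 : ((∑ j, ε j : ℤ) : ZMod 2) = 1 := by
    have h1 : ∀ j, ((ε j : ℤ) : ZMod 2) = 1 := fun j => (ZMod.intCast_eq_one_iff_odd).mpr (hodd j)
    simp [h1, (ZMod.natCast_eq_one_iff_odd).mpr hn]
  simp [h0] at h2

/-- Over a set of odd size with a transitive group of symmetries of `M`, an eigenvector for the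
eigenvalue `0` orthogonal to the all-ones vector cannot be unique up to scaling. -/
theorem Matrix.rank_add_three_le_of_transitive {n : Type*} [Fintype n]
    (hn : Odd (Fintype.card n)) {M : Matrix n n ℝ}
    (hM : ∀ u v, ∃ σ : Equiv.Perm n, σ u = v ∧ M.submatrix σ σ = M) (h1 : M *ᵥ 1 = 0)
    {x : n → ℝ} (hx0 : x ≠ 0) (hx1 : x ⬝ᵥ 1 = 0) (hx : M *ᵥ x = 0) :
    M.rank + 3 ≤ Fintype.card n := by
  have hsum : ∑ i, x i = 0 := by simpa [dotProduct] using hx1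
  obtain ⟨u, v, huv⟩ : ∃ u v, x u ^ 2 ≠ x v ^ 2 := by
    by_contra! h
    exact hx0 (eq_zero_of_sum_eq_zero_of_sq_eq hn hsum h)
  obtain ⟨σ, rfl, hσ⟩ := hM u v
  have hy : M *ᵥ (x ∘ σ) = 0 := by
    rw [← hσ, submatrix_mulVec_equiv]
    simp [Function.comp_assoc, hx]
  have hysum : ∑ i, x (σ i) = 0 := by rw [Equiv.sum_comp σ x, hsum]
  have hpos : (∑ i, x i ^ 2) ≠ 0 := by
    intro h
    rw [Finset.sum_eq_zero_iff_of_nonneg fun i _ => sq_nonneg _] at h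
    exact hx0 (funext fun i => by simpa using h i (Finset.mem_univ i))
  have hli : LinearIndependent ℝ ![1, x, x ∘ σ] := by
    rw [Fintype.linearIndependent_iff]
    intro g hg
    have hpt : ∀ i, g 0 + g 1 * x i + g 2 * x (σ i) = 0 := fun i => by
      simpa [Fin.sum_univ_three] using congrFun hg i
    have h0 : g 0 = 0 := by
      have h := Finset.sum_congr (rfl : Finset.univ = Finset.univ) fun i _ => hpt i
      simp only [Finset.sum_add_distrib, ← Finset.mul_sum, hsum, hysum] at h
      simpa [(Nat.pos_of_ne_zero fun h => by simp [h] at hn : 0 < Fintype.card n).ne'] using h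
    -- A permutation preserves the sum of squares, so a dependence forces `x ∘ σ = ±x`, contrary to
    -- the choice of `u`.
    have hsq : g 1 ^ 2 = g 2 ^ 2 := by
      have h : ∑ i, g 1 ^ 2 * x i ^ 2 = ∑ i, g 2 ^ 2 * x (σ i) ^ 2 :=
        Finset.sum_congr rfl fun i _ => by
          have := hpt i
          rw [h0, zero_add, add_eq_zero_iff_eq_neg] at this
          rw [← mul_pow, ← mul_pow, this, neg_sq]
      rw [← Finset.mul_sum, ← Finset.mul_sum, Equiv.sum_comp σ fun i => x i ^ 2] at h
      exact mul_right_cancel₀ hpos h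
    have h2 : g 2 = 0 := by
      by_contra h
      have := hpt u
      rw [h0, zero_add, add_eq_zero_iff_eq_neg] at this
      refine huv (mul_left_cancel₀ (pow_ne_zero 2 h) ?_)
      rw [← mul_pow (g 2) (x (σ u)), ← neg_sq (g 2 * _), ← this, mul_pow, hsq]
    have h1 : g 1 = 0 := by simpa [h2] using hsq
    intro i
    fin_cases i <;> assumption
  have hspan : Submodule.span ℝ (Set.range ![1, x, x ∘ σ]) ≤ LinearMap.ker M.mulVecLin := by
    rw [Submodule.span_le]
    rintro _ ⟨i, rfl⟩
    fin_cases i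
    · simpa using h1
    · simpa using hx
    · simpa using hy
  have h3 := Submodule.finrank_mono hspan
  rw [finrank_span_eq_card hli, Fintype.card_fin] at h3
  have h4 := M.mulVecLin.finrank_range_add_finrank_ker
  rw [finrank_fintype_fun_eq_card] at h4
  rw [rank]
  omega

namespace SimpleGraph

variable {V : Type*}

theorem IsVertexTransitive.exists_isRegularOfDegree [Fintype V] {G : SimpleGraph V}
    [DecidableRel G.Adj] (hG : G.IsVertexTransitive) : ∃ k, G.IsRegularOfDegree k := by
  rcases isEmpty_or_nonempty V with _ | ⟨⟨u⟩⟩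
  · exact ⟨0, fun v => isEmptyElim v⟩
  · refine ⟨G.degree u, fun v => ?_⟩
    obtain ⟨φ, rfl⟩ := hG u v
    exact φ.degree_eq u

theorem IsVertexTransitive.exists_adj_and_not_adj {G : SimpleGraph V}
    (hG : G.IsVertexTransitive) (htop : G ≠ ⊤) (hbot : G ≠ ⊥) :
    ∃ u v w, G.Adj u v ∧ u ≠ w ∧ ¬ G.Adj u w := by
  obtain ⟨a, b, hab⟩ := ne_bot_iff_exists_adj.mp hbot
  obtain ⟨u, w, huw, hn⟩ := ne_top_iff_exists_not_adj.mp htop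
  obtain ⟨φ, rfl⟩ := hG a u
  exact ⟨φ a, φ b, w, φ.map_adj_iff.mpr hab, huw, hn⟩

/-- A signed multiple of the adjacency matrix, shifted so as to be positive semidefinite, yields a
representation as soon as its off-diagonal entries give positive squared distances. -/
theorem isRepresentable_of_posSemidef [Fintype V] [DecidableEq V] {G : SimpleGraph V}
    [DecidableRel G.Adj] {s l c : ℝ} {d : ℕ} (hs : s ≠ 0)
    (hM : (s • G.adjMatrix ℝ - l • 1 + of fun _ _ => c).PosSemidef)
    (hd : (s • G.adjMatrix ℝ - l • 1 + of fun _ _ => c).rank ≤ d)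
    (hadj : 0 < -2 * l - 2 * s) (hnadj : 0 < -2 * l) : G.IsRepresentable d := by
  obtain ⟨f, hf⟩ := hM.exists_norm_sub_sq hd
  have hα : ∀ u v, G.Adj u v → ‖f u - f v‖ = √(-2 * l - 2 * s) := fun u v h => by
    rw [eq_comm, Real.sqrt_eq_iff_eq_sq hadj.le (norm_nonneg _), hf]
    simp [h, h.ne]
    ring
  have hβ : ∀ u v, u ≠ v → ¬ G.Adj u v → ‖f u - f v‖ = √(-2 * l) := fun u v hne h => by
    rw [eq_comm, Real.sqrt_eq_iff_eq_sq hnadj.le (norm_nonneg _), hf]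
    simp [h, hne]
    ring
  have hinj : Function.Injective f := by
    intro u v huv
    by_contra hne
    by_cases h : G.Adj u v
    · have := hα u v h
      rw [huv, sub_self, norm_zero] at this
      exact (Real.sqrt_pos.mpr hadj).ne this
    · have := hβ u v hne h
      rw [huv, sub_self, norm_zero] at this
      exact (Real.sqrt_pos.mpr hnadj).ne this
  refine ⟨⟨f, hinj⟩, √(-2 * l - 2 * s), √(-2 * l), Real.sqrt_pos.mpr hadj,
    Real.sqrt_pos.mpr hnadj, fun h => hs ?_, fun u v hne => ⟨hα u v, hβ u v hne⟩⟩
  rw [Real.sqrt_inj hadj.le hnadj.le] at h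
  linarith

theorem IsVertexTransitive.exists_posSemidef [Fintype V] [DecidableEq V] [Nontrivial V]
    {G : SimpleGraph V} [DecidableRel G.Adj] (hG : G.IsVertexTransitive)
    (hodd : Odd (Fintype.card V)) (s : ℝ) :
    ∃ l c : ℝ, (s • G.adjMatrix ℝ - l • 1 + of fun _ _ => c).PosSemidef ∧
      (s • G.adjMatrix ℝ - l • 1 + of fun _ _ => c).rank + 3 ≤ Fintype.card V := by
  obtain ⟨k, hk⟩ := hG.exists_isRegularOfDegree
  have hrow : (s • G.adjMatrix ℝ) *ᵥ 1 = (s * k) • 1 := by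
    rw [smul_mulVec]
    ext u
    simp [mulVec, dotProduct, adjMatrix_apply, Finset.sum_boole, ← hk u,
      ← card_neighborFinset_eq_degree, neighborFinset_eq_filter]
  obtain ⟨l, c, x, hx0, hx1, hM, hM1, hMx⟩ :=
    (G.isSymm_adjMatrix.smul s).exists_posSemidef_sub_smul_one_add_const hrow
  refine ⟨l, c, hM, rank_add_three_le_of_transitive hodd (fun u v => ?_) hM1 hx0 hx1 hMx⟩
  obtain ⟨φ, hφ⟩ := hG u v
  refine ⟨φ.toEquiv, hφ, ?_⟩
  ext i j
  simp [adjMatrix_apply, one_apply, show G.Adj (φ i) (φ j) ↔ G.Adj i j from φ.map_adj_iff]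

end SimpleGraph

/-- If two points of a Gram matrix coincide, then so do the corresponding columns. -/
theorem Matrix.PosSemidef.apply_eq_of_dist_eq_zero {n : Type*} [Fintype n] {M : Matrix n n ℝ}
    (hM : M.PosSemidef) {u v : n} (h : M u u + M v v - 2 * M u v = 0) (w : n) :
    M w u = M w v := by
  classical
  have hsymm : M v u = M u v := by simpa using hM.isHermitian.apply u v
  have h0 : M *ᵥ (Pi.single u 1 - Pi.single v 1) = 0 := by
    rw [← hM.dotProduct_mulVec_zero_iff, star_trivial]
    simp [mulVec_sub, sub_dotProduct, hsymm]
    linarith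
  simpa [mulVec_sub, sub_eq_zero] using congrFun h0 w

theorem Matrix.PosSemidef.dist_nonneg {n : Type*} [Fintype n] {M : Matrix n n ℝ}
    (hM : M.PosSemidef) (u v : n) : 0 ≤ M u u + M v v - 2 * M u v := by
  obtain ⟨f, hf⟩ := hM.exists_norm_sub_sq le_rfl
  rw [← hf]
  positivity

theorem mainTheorem9 {V : Type*} [Fintype V] (G : SimpleGraph V)
    (hG : G.IsVertexTransitive) (hodd : Odd (Fintype.card V))
    (hcomplete : G ≠ ⊤) (hempty : G ≠ ⊥) :
    3 ≤ Fintype.card V ∧ G.IsRepresentable (Fintype.card V - 3) := by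
  classical
  obtain ⟨u, v, w, huv, huw, hnuw⟩ := hG.exists_adj_and_not_adj hcomplete hempty
  have hvw : v ≠ w := by
    rintro rfl
    exact hnuw huv
  have : Nontrivial V := ⟨u, w, huw⟩
  obtain ⟨l, c, hM, hrank⟩ := hG.exists_posSemidef hodd 1
  obtain ⟨l', c', hM', hrank'⟩ := hG.exists_posSemidef hodd (-1)
  refine ⟨by omega, ?_⟩
  have h1 := hM.dist_nonneg u v
  have h2 := hM'.dist_nonneg u w
  have e1 := hM.apply_eq_of_dist_eq_zero (u := u) (v := v)
  have e2 := hM'.apply_eq_of_dist_eq_zero (u := u) (v := w)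
  simp [huv, huv.ne] at h1
  simp [hnuw, huw] at h2
  rcases lt_or_ge l (-1) with hl | hl
  · exact G.isRepresentable_of_posSemidef one_ne_zero hM (by omega) (by linarith) (by linarith)
  rcases lt_or_ge l' 0 with hl' | hl'
  · exact G.isRepresentable_of_posSemidef (by norm_num) hM' (by omega) (by linarith) (by linarith)
  -- Now `l = -1` and `l' = 0`: ends of an edge coincide in the first Gram matrix, non-adjacent
  -- vertices in the second. Equal columns make `v`, `w` non-adjacent by the first and adjacent by
  -- the second.
  exfalso
  have e1 := e1 (by simp [huv, huv.ne]; linarith) w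
  have e2 := e2 (by simp [hnuw, huw]; linarith) v
  have hnvw : ¬ G.Adj w v := by
    intro h
    simp [h, huw.symm, hvw.symm, G.adj_comm w u, hnuw] at e1
  simp [huv.symm, huv.ne', hvw, G.adj_comm v w, hnvw] at e2
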